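/- Let $k$ be an algebraically closed field (of any characteristic). For a point $p\in\mathbb P^3=\mathbb P^3_k$ let $I(p)\subset k[X_0,\dots,X_3]$ be its homogeneous ideal, and for points $p_1,\dots,p_8\in\mathbb P^3$ and integers $\mu,\delta\ge 0$ let $$L_\delta(\mu;p_1,\dots,p_8)=k[X_0,\dots,X_3]_\delta\cap\bigcap_{i=1}^{8} I(p_i)^{\mu}$$ be the $k$-vector space of homogeneous polynomials of degree $\delta$ that vanish at each $p_i$ to order at least $\mu$, that is, of forms of degree $\delta$ containing the eight fat points of multiplicity $\mu$ supported at $p_1,\dots,p_8$. **Proposition.** Eight general fat points of the same multiplicity in $\mathbb P^3$ impose the expected number of conditions on forms of every degree: for every integer $\mu\ge 0$ there is a nonempty Zariski open subset $U\subset(\mathbb P^3)^8$ such that for all $(p_1,\dots,p_8)\in U$ and all integers $\delta\ge 0$, $$\dim_k L_\delta(\mu;p_1,\dots,p_8)=\max\left(0,\ \binom{\delta+3}{3}-8\binom{\mu+2}{3}\right).$$ -/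

import Mathlib

open scoped LinearAlgebra.Projectivization

/-- A set of `r`-tuples of points of `ℙ^d` is Zariski open: its preimage under the quotient map
`(𝔸^{d+1} ∖ {0})^r → (ℙ^d)^r` is the locus where some polynomial of a family `S` (in the
`r (d+1)` homogeneous coordinates) is nonzero. -/
def IsZariskiOpen {k : Type*} [Field k] {d r : ℕ} (U : Set (Fin r → ℙ k (Fin (d + 1) → k))) :
    Prop :=
  ∃ S : Set (MvPolynomial (Fin r × Fin (d + 1)) k),
    ∀ (v : Fin r → Fin (d + 1) → k) (hv : ∀ i, v i ≠ 0),
      (fun i => Projectivization.mk k (v i) (hv i)) ∈ U ↔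
        ∃ f ∈ S, MvPolynomial.eval (fun ij : Fin r × Fin (d + 1) => v ij.1 ij.2) f ≠ 0

/-- The property `P` holds for `r` general points of `ℙ^d`: it holds for all tuples in some
nonempty Zariski open subset of `(ℙ^d)^r`. -/
def ForGeneralPoints {k : Type*} [Field k] {d r : ℕ}
    (P : (Fin r → ℙ k (Fin (d + 1) → k)) → Prop) : Prop :=
  ∃ U : Set (Fin r → ℙ k (Fin (d + 1) → k)), IsZariskiOpen U ∧ U.Nonempty ∧ ∀ p ∈ U, P p

/-- The homogeneous ideal `I(q)` of a point `q` of `ℙ^d`, generated by the forms vanishing at `q`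
(whether a form vanishes does not depend on the representative of `q`). -/
noncomputable def pointIdeal {k : Type*} [Field k] {d : ℕ} (q : ℙ k (Fin (d + 1) → k)) :
    Ideal (MvPolynomial (Fin (d + 1)) k) :=
  Ideal.span {f | (∃ n : ℕ, f.IsHomogeneous n) ∧ MvPolynomial.eval q.rep f = 0}

/-- The space of forms of degree `δ` on `ℙ^d` that vanish at each `p i` to order at least `m i`,
that is, the degree `δ` part of the ideal `⋂ i, I(p i) ^ m i` of the union of the fat points of
multiplicity `m i` at `p i`. -/
noncomputable def fatPointForms {k : Type*} [Field k] {d r : ℕ} (δ : ℕ) (m : Fin r → ℕ)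
    (p : Fin r → ℙ k (Fin (d + 1) → k)) : Submodule k (MvPolynomial (Fin (d + 1)) k) :=
  MvPolynomial.homogeneousSubmodule (Fin (d + 1)) k δ ⊓
    ⨅ i, (pointIdeal (p i) ^ m i).restrictScalars k

/-- The virtual dimension of the space of forms of degree `δ` on `ℙ^d` through `r` points of
multiplicity `μ`. For `d ≥ 1`, the natural subtraction in `d + μ - 1` does not truncate. -/
def virtualDim (d δ r μ : ℕ) : ℤ :=
  ((δ + d).choose d : ℤ) - (r : ℤ) * ((d + μ - 1).choose d : ℤ)

/-! For `μ > 0` it suffices to treat two degrees at one special configuration. In degree `2 μ` the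
virtual dimension is `μ + 1`, and in degree `2 μ - 1` it is at most `0`. If no form of degree `2 μ -
1` passes through the fat points, none of lower degree does; if the conditions are independent in
degree `2 μ`, they stay so above, because multiplying by a linear form that avoids the points shows
that the number of conditions does not drop (`finrank_fatPointForms_succ_le`). The two properties
are injectivity and surjectivity of a matrix polynomial in the points, hence open.

The special points lie on the coordinate quadrilateral `x₀x₂ = x₁x₃ = 0`, at parameters `1` and `t`
on each of its four lines. The core is `coeff_eq_zero_of_quadrilateralOrder_lt`: forms of degree at
most `2 μ` through these fat points lie in `(x₀x₂, x₁x₃) ^ μ`. To see this, take the lowest-order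
terms along the quadrilateral, say of order `j < μ`, and put `n = μ - j`. On each line their
coefficient is a constant times `X ^ A (X - 1) ^ n (X - t) ^ n`, so its two extreme coefficients
have ratio `t ^ n`. In degree `2 μ` these belong to the corners of the quadrilateral and are shared
by adjacent lines. Going round the cycle multiplies a corner coefficient by `t ^ (4 n)`, so it
vanishes once `t ^ (4 n) ≠ 1`; in lower degree the top coefficient is zero anyway. Hence there are
no forms below degree `2 μ`, and in degree `2 μ` only combinations of the `μ + 1` products `(x₀x₂) ^
i (x₁x₃) ^ (μ - i)`. -/

open MvPolynomial

/-! ### Moving a point to a coordinate point. -/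

section Shear

variable {R σ : Type*} [CommRing R] [DecidableEq σ]

/-- The linear substitution fixing the coordinates other than `j` of the dual basis and sending the
`j`-th coordinate point to the point `v`. -/
noncomputable def shear (j : σ) (v : σ → R) : MvPolynomial σ R →ₐ[R] MvPolynomial σ R :=
  aeval fun l => if l = j then C (v j) * X j else X l + C (v l) * X j

/-- The ideal of the `j`-th coordinate point. -/
noncomputable def coordIdeal (R : Type*) {σ : Type*} [CommRing R] (j : σ) :
    Ideal (MvPolynomial σ R) :=
  Ideal.span (X '' {j}ᶜ)

theorem shear_X_self (j : σ) (v : σ → R) : shear j v (X j) = C (v j) * X j := by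
  simp [shear]

theorem shear_X_of_ne {j l : σ} (h : l ≠ j) (v : σ → R) :
    shear j v (X l) = X l + C (v l) * X j := by
  simp [shear, h]

theorem isHomogeneous_shear (j : σ) (v : σ → R) {f : MvPolynomial σ R} {n : ℕ}
    (hf : f.IsHomogeneous n) : (shear j v f).IsHomogeneous n := by
  have := hf.aeval (n := 1)
    (fun l => if l = j then C (v j) * X j else X l + C (v l) * X j) (fun l => by
      split_ifs
      · exact (isHomogeneous_X _ _).C_mul _
      · exact (isHomogeneous_X _ _).add ((isHomogeneous_X _ _).C_mul _))
  simpa [shear] using this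

/-- Base change lets a computation at generic points specialise to actual ones. -/
theorem map_shear {S : Type*} [CommRing S] (φ : R →+* S) (j : σ) (v : σ → R)
    (f : MvPolynomial σ R) :
    map φ (shear j v f) = shear j (fun l => φ (v l)) (map φ f) := by
  induction f using MvPolynomial.induction_on with
  | C a => simp [shear]
  | add p q hp hq => simp [hp, hq]
  | mul_X p l hp =>
    rw [map_mul, map_mul, hp, map_mul, map_mul, map_X]
    congr 1
    by_cases h : l = j
    · subst h; simp [shear_X_self]
    · simp [shear_X_of_ne h]

/-- Membership in a power of a coordinate point ideal is a condition on coefficients. -/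
theorem mem_coordIdeal_pow {j : σ} {a : ℕ} {f : MvPolynomial σ R} :
    f ∈ coordIdeal R j ^ a ↔ ∀ m : σ →₀ ℕ, m.degree < m j + a → coeff m f = 0 := by
  constructor
  · intro hf
    induction a generalizing f with
    | zero =>
      intro m hm
      have := Finsupp.le_degree j m
      omega
    | succ a ih =>
      rw [pow_succ] at hf
      refine Submodule.mul_induction_on hf (fun r hr s hs m hm => ?_) (fun x y hx hy m hm => ?_)
      · rw [coeff_mul]
        refine Finset.sum_eq_zero fun x hx => ?_
        rw [Finset.HasAntidiagonal.mem_antidiagonal] at hx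
        subst hx
        rw [map_add, Finsupp.add_apply] at hm
        by_cases h : x.1.degree < x.1 j + a
        · rw [ih hr _ h, zero_mul]
        · have h2 : x.2.degree < x.2 j + 1 := by omega
          rw [coordIdeal, mem_ideal_span_X_image] at hs
          by_cases h0 : coeff x.2 s = 0
          · rw [h0, mul_zero]
          · obtain ⟨i, hi, hne⟩ := hs x.2 (mem_support_iff.2 h0)
            exfalso
            -- `x.2` is a pure power of `X j`, which cannot occur in an element of the coordinate
            -- ideal.
            have h3 : (x.2.erase j).degree = 0 := by
              have h4 := congrArg Finsupp.degree (Finsupp.single_add_erase j x.2)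
              rw [map_add, Finsupp.degree_single] at h4
              omega
            rw [Finsupp.degree_eq_zero_iff] at h3
            have h5 := DFunLike.congr_fun h3 i
            rw [Finsupp.erase_ne hi] at h5
            exact hne h5
      · rw [coeff_add, hx m hm, hy m hm, add_zero]
  · intro h
    rw [f.as_sum]
    refine Ideal.sum_mem _ fun m hm => ?_
    have h1 : m j + a ≤ m.degree := by
      by_contra h2
      exact mem_support_iff.1 hm (h m (by omega))
    have h4 := congrArg Finsupp.degree (Finsupp.single_add_erase j m)
    rw [map_add, Finsupp.degree_single] at h4
    have h5 : monomial m (coeff m f) =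
        monomial (Finsupp.single j (m j)) (coeff m f) * monomial (m.erase j) 1 := by
      rw [monomial_mul, Finsupp.single_add_erase, mul_one]
    rw [h5]
    refine Ideal.mul_mem_left _ _ (Ideal.pow_le_pow_right (show a ≤ (m.erase j).degree by omega) ?_)
    rw [monomial_eq, C_1, one_mul, Finsupp.degree_apply,
      ← Finset.prod_pow_eq_pow_sum]
    refine Ideal.prod_mem_prod fun i hi => Ideal.pow_mem_pow ?_ _
    refine Ideal.subset_span ⟨i, ?_, rfl⟩
    rintro rfl
    simp at hi

/-- A linear form not vanishing at a coordinate point is a nonzerodivisor modulo the powers of its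
ideal. -/
theorem mem_coordIdeal_pow_of_mul_mem {K : Type*} [Field K] [Fintype σ] {j : σ} {a : ℕ}
    {c : σ → K} (hc : c j ≠ 0) {f : MvPolynomial σ K}
    (hf : (∑ l, C (c l) * X l) * f ∈ coordIdeal K j ^ a) : f ∈ coordIdeal K j ^ a := by
  rw [mem_coordIdeal_pow] at hf ⊢
  -- Induction on the order `w` of `m` at the point. In the coefficient of the product at `m + e_j`,
  -- every term other than `c j * coeff m f` involves a monomial of order `w - 1`.
  have key : ∀ w, ∀ m : σ →₀ ℕ, m.degree = m j + w → w < a → coeff m f = 0 := by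
    intro w
    induction w using Nat.strong_induction_on with
    | _ w ih =>
      intro m hm hw
      have h1 := hf (m + Finsupp.single j 1) (by
        rw [map_add, Finsupp.degree_single, Finsupp.add_apply, Finsupp.single_eq_same]; omega)
      rw [Finset.sum_mul, coeff_sum, Finset.sum_eq_single j] at h1
      · rw [mul_assoc, coeff_C_mul, add_comm, coeff_X_mul] at h1
        exact (mul_eq_zero.1 h1).resolve_left hc
      · intro l _ hl
        rw [mul_assoc, coeff_C_mul, coeff_X_mul']
        split_ifs with hs
        · set m' := m + Finsupp.single j 1 - Finsupp.single l 1 with hm'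
          have h2 : m' + Finsupp.single l 1 = m + Finsupp.single j 1 :=
            tsub_add_cancel_of_le (by
              rw [Finsupp.single_le_iff]
              exact Nat.one_le_iff_ne_zero.2 (Finsupp.mem_support_iff.1 hs))
          have h3 := congrArg Finsupp.degree h2
          have h4 := DFunLike.congr_fun h2 j
          simp only [map_add, Finsupp.degree_single] at h3
          simp only [Finsupp.add_apply, Finsupp.single_eq_same,
            Finsupp.single_eq_of_ne hl.symm] at h4
          have h5 := Finsupp.le_degree j m'
          rw [ih (w - 1) (by omega) m' (by omega) (by omega), mul_zero]
        · rw [mul_zero]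
      · simp
  intro m hm
  have := Finsupp.le_degree j m
  exact key (m.degree - m j) m (by omega) (by omega)

end Shear

/-! ### Powers of point ideals in a chart. -/

section PointIdeal

theorem MvPolynomial.IsHomogeneous.degree_eq {R σ : Type*} [CommSemiring R]
    {f : MvPolynomial σ R} {n : ℕ} (hf : f.IsHomogeneous n) {m : σ →₀ ℕ} (hm : coeff m f ≠ 0) :
    m.degree = n := by
  rw [Finsupp.degree_eq_weight_one]
  exact hf hm

variable {k : Type*} [Field k] {d : ℕ}

theorem eval_smul_of_isHomogeneous {σ : Type*} {f : MvPolynomial σ k} {n : ℕ}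
    (hf : f.IsHomogeneous n) (a : k) (v : σ → k) : eval (a • v) f = a ^ n * eval v f := by
  rw [eval_eq, eval_eq, Finset.mul_sum]
  refine Finset.sum_congr rfl fun m hm => ?_
  have h := hf.degree_eq (mem_support_iff.1 hm)
  rw [Finsupp.degree_apply] at h
  simp only [Pi.smul_apply, smul_eq_mul, mul_pow, Finset.prod_mul_distrib]
  rw [Finset.prod_pow_eq_pow_sum, h]
  ring

theorem eval_rep_eq_zero_iff {f : MvPolynomial (Fin (d + 1)) k} {n : ℕ} (hf : f.IsHomogeneous n)
    (v : Fin (d + 1) → k) (hv : v ≠ 0) :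
    eval (Projectivization.mk k v hv).rep f = 0 ↔ eval v f = 0 := by
  obtain ⟨a, ha⟩ := Projectivization.exists_smul_eq_mk_rep k v hv
  rw [← ha, Units.smul_def, eval_smul_of_isHomogeneous hf]
  simp

theorem pointIdeal_le_ker_eval (v : Fin (d + 1) → k) (hv : v ≠ 0) :
    pointIdeal (Projectivization.mk k v hv) ≤ RingHom.ker (eval v) := by
  rw [pointIdeal, Ideal.span_le]
  rintro f ⟨⟨n, hn⟩, h⟩
  exact (eval_rep_eq_zero_iff hn v hv).1 h

/-- Modulo the coordinate ideal the shear sends `X l` to `v l * X j`, hence `f` to `f(v) * X j ^ n`.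
-/
theorem shear_mem_coordIdeal {v : Fin (d + 1) → k} {j : Fin (d + 1)} {n : ℕ}
    {f : MvPolynomial (Fin (d + 1)) k} (hf : f.IsHomogeneous n) (h : eval v f = 0) :
    shear j v f ∈ coordIdeal k j := by
  have h0 : ∀ g : MvPolynomial (Fin (d + 1)) k,
      shear j v g - aeval (fun l => C (v l) * X j) g ∈ coordIdeal k j := by
    intro g
    induction g using MvPolynomial.induction_on with
    | C a => simp [shear]
    | add p q hp hq =>
      rw [map_add, map_add, add_sub_add_comm]
      exact add_mem hp hq
    | mul_X p l hp =>
      have hl : shear j v (X l) - C (v l) * X j ∈ coordIdeal k j := by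
        by_cases hl : l = j
        · subst hl; rw [shear_X_self, sub_self]; exact zero_mem _
        · rw [shear_X_of_ne hl, add_sub_cancel_right]
          exact Ideal.subset_span ⟨l, hl, rfl⟩
      rw [map_mul, map_mul, aeval_X]
      convert add_mem (Ideal.mul_mem_right (shear j v (X l)) _ hp)
        (Ideal.mul_mem_left _ (aeval (fun l => C (v l) * X j) p) hl) using 1
      ring
  have h1 : aeval (fun l => C (v l) * X j) f = (0 : MvPolynomial (Fin (d + 1)) k) := by
    rw [aeval_def, eval₂_eq]
    have h2 : ∀ m ∈ f.support, algebraMap k (MvPolynomial (Fin (d + 1)) k) (coeff m f) *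
        ∏ i ∈ m.support, (C (v i) * X j) ^ m i =
        C (coeff m f * ∏ i ∈ m.support, v i ^ m i) * X j ^ n := by
      intro m hm
      have h := hf.degree_eq (mem_support_iff.1 hm)
      rw [Finsupp.degree_apply] at h
      simp only [mul_pow, Finset.prod_mul_distrib]
      rw [Finset.prod_pow_eq_pow_sum, h]
      simp [algebraMap_eq, mul_assoc]
    rw [Finset.sum_congr rfl h2, ← Finset.sum_mul, ← map_sum, ← eval_eq, h, C_0, zero_mul]
  have h2 := h0 f
  rwa [h1, sub_zero] at h2

/-- In the chart of a nonzero coordinate of the point, membership in a power of a point ideal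
becomes membership in a power of the ideal of a coordinate point. -/
theorem mem_pointIdeal_pow_iff {v : Fin (d + 1) → k} (hv : v ≠ 0) {j : Fin (d + 1)}
    (hj : v j ≠ 0) {a : ℕ} {f : MvPolynomial (Fin (d + 1)) k} :
    f ∈ pointIdeal (Projectivization.mk k v hv) ^ a ↔ shear j v f ∈ coordIdeal k j ^ a := by
  constructor
  · intro hf
    have : pointIdeal (Projectivization.mk k v hv) ≤ (coordIdeal k j).comap (shear j v) := by
      rw [pointIdeal, Ideal.span_le]
      rintro g ⟨⟨n, hn⟩, h⟩
      exact shear_mem_coordIdeal hn ((eval_rep_eq_zero_iff hn v hv).1 h)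
    exact Ideal.le_comap_pow _ _ (Ideal.pow_right_mono this a hf)
  · intro hf
    -- Inverse substitution; it takes the generators of the coordinate ideal to linear forms
    -- vanishing at `v`.
    let ψ : MvPolynomial (Fin (d + 1)) k →ₐ[k] MvPolynomial (Fin (d + 1)) k :=
      aeval fun l => if l = j then C (v j)⁻¹ * X j else X l - C (v l / v j) * X j
    have hψ : ∀ l, l ≠ j → ψ (X l) = X l - C (v l / v j) * X j := fun l hl => by simp [ψ, hl]
    have hψj : ψ (X j) = C (v j)⁻¹ * X j := by simp [ψ]
    have hid : ψ.comp (shear j v) = AlgHom.id k _ := by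
      ext1 l
      simp only [AlgHom.comp_apply, AlgHom.id_apply]
      have hC : ∀ c, ψ (C c) = C c := fun c => ψ.commutes c
      by_cases hl : l = j
      · subst hl
        rw [shear_X_self, map_mul, hψj, hC, ← mul_assoc, ← C_mul, mul_inv_cancel₀ hj, C_1, one_mul]
      · rw [shear_X_of_ne hl, map_add, map_mul, hψj, hC, hψ l hl, ← mul_assoc, ← C_mul,
          ← div_eq_mul_inv, sub_add_cancel]
    have : coordIdeal k j ≤ (pointIdeal (Projectivization.mk k v hv)).comap ψ := by
      rw [coordIdeal, Ideal.span_le]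
      rintro _ ⟨l, hl, rfl⟩
      have hh : (ψ (X l)).IsHomogeneous 1 := by
        rw [hψ l hl]
        exact (isHomogeneous_X _ _).sub ((isHomogeneous_X _ _).C_mul _)
      refine Ideal.subset_span ⟨⟨1, hh⟩, (eval_rep_eq_zero_iff hh v hv).2 ?_⟩
      rw [hψ l hl]
      simp [hj]
    have h2 := Ideal.le_comap_pow _ _ (Ideal.pow_right_mono this a hf)
    rw [Ideal.mem_comap, ← AlgHom.comp_apply, hid] at h2
    exact h2

/-- A linear form not vanishing at a point is a nonzerodivisor modulo the powers of its ideal. -/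
theorem mem_pointIdeal_pow_of_mul_mem {v : Fin (d + 1) → k} (hv : v ≠ 0) {c : Fin (d + 1) → k}
    (hc : ∑ l, c l * v l ≠ 0) {a : ℕ} {f : MvPolynomial (Fin (d + 1)) k}
    (hf : (∑ l, C (c l) * X l) * f ∈ pointIdeal (Projectivization.mk k v hv) ^ a) :
    f ∈ pointIdeal (Projectivization.mk k v hv) ^ a := by
  obtain ⟨j, hj⟩ : ∃ j, v j ≠ 0 := by
    by_contra! h
    exact hv (funext h)
  rw [mem_pointIdeal_pow_iff hv hj] at hf ⊢
  rw [map_mul] at hf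
  -- The shear changes only the `j`-th coefficient of the linear form, which becomes its value at
  -- `v`.
  refine mem_coordIdeal_pow_of_mul_mem (c := Function.update c j (∑ l, c l * v l)) (by simpa) ?_
  convert hf using 2
  rw [map_sum, ← Finset.add_sum_erase _ _ (Finset.mem_univ j),
    ← Finset.add_sum_erase _ (fun l => shear j v (C (c l) * X l)) (Finset.mem_univ j)]
  have h1 : ∀ l, shear j v (C (c l) * X l) = C (c l) * shear j v (X l) := fun l => by
    rw [map_mul]; congr 1; exact (shear j v).commutes _
  have h2 : ∀ l ∈ Finset.univ.erase j, shear j v (C (c l) * X l) =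
      C (c l) * X l + C (c l * v l) * X j := fun l hl => by
    rw [h1, shear_X_of_ne (Finset.ne_of_mem_erase hl), C_mul]; ring
  have h3 : ∀ l ∈ Finset.univ.erase j,
      C (Function.update c j (c j * v j + ∑ l ∈ Finset.univ.erase j, c l * v l) l) * X l =
      (C (c l) * X l : MvPolynomial (Fin (d + 1)) k) := fun l hl => by
    rw [Function.update_of_ne (Finset.ne_of_mem_erase hl)]
  rw [Finset.sum_congr rfl h2, Finset.sum_add_distrib, h1, shear_X_self, Function.update_self,
    ← Finset.add_sum_erase _ _ (Finset.mem_univ j), C_add, map_sum, ← Finset.sum_mul,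
    Finset.sum_congr rfl h3, C_mul]
  ring

end PointIdeal

/-! ### Open conditions in polynomial families and on tuples of points. -/

section Openness

variable {k τ W X : Type*} [Field k]

/-- Bijectivity is an open condition in a polynomial family of endomorphisms. -/
theorem exists_polynomial_bijective [AddCommGroup W] [Module k W] [FiniteDimensional k W]
    (T : (τ → k) → W →ₗ[k] W)
    (hT : ∀ (w : W) (ℓ : W →ₗ[k] k), ∃ P : MvPolynomial τ k, ∀ v, eval v P = ℓ (T v w))
    (v₀ : τ → k) (h₀ : Function.Bijective (T v₀)) :
    ∃ f : MvPolynomial τ k, eval v₀ f ≠ 0 ∧ ∀ v, eval v f ≠ 0 → Function.Bijective (T v) := by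
  choose P hP using hT
  let b := Module.finBasis k W
  let N : Matrix (Fin (Module.finrank k W)) (Fin (Module.finrank k W)) (MvPolynomial τ k) :=
    Matrix.of fun i j => P (b j) (b.coord i)
  have hN : ∀ v, eval v N.det = LinearMap.det (T v) := by
    intro v
    rw [RingHom.map_det, ← LinearMap.det_toMatrix b]
    congr 1
    ext i j
    simp [N, hP, LinearMap.toMatrix_apply]
  have hiff : ∀ v, eval v N.det ≠ 0 ↔ Function.Bijective (T v) := fun v => by
    rw [hN, ← isUnit_iff_ne_zero, ← LinearMap.isUnit_iff_isUnit_det, Module.End.isUnit_iff]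
  exact ⟨N.det, (hiff v₀).2 h₀, fun v => (hiff v).1⟩

variable [AddCommGroup W] [Module k W] [AddCommGroup X] [Module k X]

/-- Injectivity is an open condition in a polynomial family of linear maps. -/
theorem exists_polynomial_injective [FiniteDimensional k W] (L : (τ → k) → W →ₗ[k] X)
    (hL : ∀ (w : W) (ℓ : X →ₗ[k] k), ∃ P : MvPolynomial τ k, ∀ v, eval v P = ℓ (L v w))
    (v₀ : τ → k) (h₀ : Function.Injective (L v₀)) :
    ∃ f : MvPolynomial τ k, eval v₀ f ≠ 0 ∧ ∀ v, eval v f ≠ 0 → Function.Injective (L v) := by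
  -- A left inverse fixed at `v₀` turns the family into endomorphisms, to which the determinant
  -- applies.
  obtain ⟨B, hB⟩ := (L v₀).exists_leftInverse_of_injective (LinearMap.ker_eq_bot.2 h₀)
  obtain ⟨f, hf₀, hf⟩ := exists_polynomial_bijective (fun v => B ∘ₗ L v)
    (fun w ℓ => hL w (ℓ ∘ₗ B)) v₀ (by rw [hB]; exact Function.bijective_id)
  refine ⟨f, hf₀, fun v hv => Function.Injective.of_comp (f := B) ?_⟩
  exact (hf v hv).1

/-- Surjectivity is an open condition in a polynomial family of linear maps. -/
theorem exists_polynomial_surjective [FiniteDimensional k X] (L : (τ → k) → W →ₗ[k] X)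
    (hL : ∀ (w : W) (ℓ : X →ₗ[k] k), ∃ P : MvPolynomial τ k, ∀ v, eval v P = ℓ (L v w))
    (v₀ : τ → k) (h₀ : Function.Surjective (L v₀)) :
    ∃ f : MvPolynomial τ k, eval v₀ f ≠ 0 ∧ ∀ v, eval v f ≠ 0 → Function.Surjective (L v) := by
  obtain ⟨B, hB⟩ := (L v₀).exists_rightInverse_of_surjective (LinearMap.range_eq_top.2 h₀)
  obtain ⟨f, hf₀, hf⟩ := exists_polynomial_bijective (fun v => L v ∘ₗ B)
    (fun w ℓ => hL (B w) ℓ) v₀ (by rw [hB]; exact Function.bijective_id)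
  refine ⟨f, hf₀, fun v hv => Function.Surjective.of_comp (g := B) ?_⟩
  exact (hf v hv).2

/-- A property of tuples of points holds generally if it holds wherever a polynomial in the
coordinates of representatives, not vanishing identically on tuples of nonzero vectors, is
nonzero. -/
theorem forGeneralPoints_of_polynomial {d r : ℕ} {P : (Fin r → ℙ k (Fin (d + 1) → k)) → Prop}
    (f : MvPolynomial (Fin r × Fin (d + 1)) k) (v₀ : Fin r → Fin (d + 1) → k)
    (hv₀ : ∀ i, v₀ i ≠ 0) (hf₀ : eval (fun ij : Fin r × Fin (d + 1) => v₀ ij.1 ij.2) f ≠ 0)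
    (h : ∀ (v : Fin r → Fin (d + 1) → k) (hv : ∀ i, v i ≠ 0),
      eval (fun ij : Fin r × Fin (d + 1) => v ij.1 ij.2) f ≠ 0 →
        P fun i => Projectivization.mk k (v i) (hv i)) :
    ForGeneralPoints P := by
  -- `f` need not be multihomogeneous, so all its rescalings are used: the open set consists of
  -- tuples having some representatives where `f` is nonzero.
  let s : (Fin r → kˣ) → MvPolynomial (Fin r × Fin (d + 1)) k := fun c =>
    aeval (fun ij : Fin r × Fin (d + 1) => C (c ij.1 : k) * X ij) f
  have hs : ∀ c (v : Fin r → Fin (d + 1) → k),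
      eval (fun ij : Fin r × Fin (d + 1) => v ij.1 ij.2) (s c) =
        eval (fun ij : Fin r × Fin (d + 1) => (c ij.1 • v ij.1) ij.2) f := by
    intro c v
    rw [← coe_aeval_eq_eval, RingHom.coe_coe, ← AlgHom.comp_apply, comp_aeval, ← coe_aeval_eq_eval,
      RingHom.coe_coe]
    simp [Units.smul_def]
  refine ⟨{p | ∃ (v : Fin r → Fin (d + 1) → k) (hv : ∀ i, v i ≠ 0),
    (p = fun i => Projectivization.mk k (v i) (hv i)) ∧
      eval (fun ij : Fin r × Fin (d + 1) => v ij.1 ij.2) f ≠ 0}, ⟨Set.range s, ?_⟩,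
    ⟨_, v₀, hv₀, rfl, hf₀⟩, ?_⟩
  · intro v hv
    rw [Set.exists_range_iff]
    constructor
    · rintro ⟨w, hw, heq, hne⟩
      have : ∀ i, ∃ a : kˣ, a • v i = w i := fun i =>
        (Projectivization.mk_eq_mk_iff k _ _ (hw i) (hv i)).1 (congrFun heq i).symm
      choose c hc using this
      refine ⟨c, ?_⟩
      rw [hs]
      simpa only [hc] using hne
    · rintro ⟨c, hc⟩
      rw [hs] at hc
      refine ⟨fun i => c i • v i, fun i => (smul_ne_zero_iff_ne (c i)).2 (hv i), ?_, hc⟩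
      funext i
      exact ((Projectivization.mk_eq_mk_iff k _ _ _ (hv i)).2 ⟨c i, rfl⟩).symm
  · rintro _ ⟨v, hv, rfl, hne⟩
    exact h v hv hne

end Openness

/-! ### Dimension of the space of forms. -/

section Dimension

variable {σ : Type*} [Fintype σ] [DecidableEq σ]

theorem mem_finsuppAntidiag_univ {n : ℕ} {m : σ →₀ ℕ} :
    m ∈ Finset.univ.finsuppAntidiag n ↔ m.degree = n := by
  simp [Finset.mem_finsuppAntidiag, Finsupp.degree_eq_sum]

instance (R : Type*) [CommSemiring R] (n : ℕ) : Module.Finite R (homogeneousSubmodule σ R n) :=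
  Module.Finite.iff_fg.2 (homogeneousSubmodule_fg σ R n)

/-- Forms of degree `n` are given by their coefficients. -/
noncomputable def homogeneousSubmoduleEquiv (R : Type*) [CommSemiring R] (n : ℕ) :
    homogeneousSubmodule σ R n ≃ₗ[R] ((Finset.univ : Finset σ).finsuppAntidiag n → R) where
  toFun f m := coeff m f.1
  map_add' _ _ := by ext; simp
  map_smul' _ _ := by ext; simp
  invFun g := ⟨∑ m, monomial m.1 (g m), Submodule.sum_mem _ fun m _ =>
    isHomogeneous_monomial _ (mem_finsuppAntidiag_univ.1 m.2)⟩
  left_inv f := by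
    ext m
    rw [coeff_sum]
    simp only [coeff_monomial]
    by_cases hm : m.degree = n
    · rw [Finset.sum_eq_single ⟨m, mem_finsuppAntidiag_univ.2 hm⟩]
      · simp
      · intro x _ hx
        rw [if_neg fun h => hx (Subtype.ext h)]
      · simp
    · have h0 : coeff m f.1 = 0 := by
        by_contra h
        exact hm (IsHomogeneous.degree_eq f.2 h)
      rw [h0]
      exact Finset.sum_eq_zero fun x _ =>
        if_neg fun h : x.1 = m => hm (h ▸ mem_finsuppAntidiag_univ.1 x.2)
  right_inv g := by
    ext m
    simp only [coeff_sum, coeff_monomial]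
    rw [Finset.sum_eq_single m]
    · simp
    · intro x _ hx
      rw [if_neg fun h => hx (Subtype.ext h)]
    · simp

theorem card_finsuppAntidiag_fin (d n : ℕ) :
    ((Finset.univ : Finset (Fin (d + 1))).finsuppAntidiag n).card = (n + d).choose d := by
  rw [Finset.card_finsuppAntidiag_nat_eq_choose, Finset.card_univ, Fintype.card_fin,
    show d + 1 + n - 1 = n + d by omega, ← Nat.choose_symm (Nat.le_add_right n d),
    Nat.add_sub_cancel_left]

theorem finrank_homogeneousSubmodule_fin (k : Type*) [Field k] (d n : ℕ) :
    Module.finrank k (homogeneousSubmodule (Fin (d + 1)) k n) = (n + d).choose d := by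
  rw [(homogeneousSubmoduleEquiv k n).finrank_eq, Module.finrank_fintype_fun_eq_card,
    Fintype.card_coe, card_finsuppAntidiag_fin]

end Dimension

/-! ### Vanishing along the coordinate quadrilateral. -/

section Quadrilateral

variable {k : Type*} [Field k]

/-- The points of the lines of the coordinate quadrilateral in `ℙ³`: the point with coordinate `s`
on the line where the coordinates `a` and `a + 1` vanish. -/
def quadrilateralPoint (a : Fin 4) (s : k) : Fin 4 → k :=
  fun l => if l = a + 2 then s else if l = a + 3 then 1 else 0

theorem quadrilateralPoint_apply_add_three (a : Fin 4) (s : k) :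
    quadrilateralPoint a s (a + 3) = 1 := by
  fin_cases a <;> simp [quadrilateralPoint]

/-- Expansion of a form along the line where the coordinates `a` and `a + 1` vanish: it is a
polynomial in these two coordinates with coefficients in the affine coordinate ring of the line. -/
noncomputable def lineExpansion (a : Fin 4) :
    MvPolynomial (Fin 4) k →ₐ[k] Polynomial (Polynomial (Polynomial k)) :=
  aeval (fun l => if l = a then Polynomial.X else if l = a + 1 then Polynomial.C Polynomial.X
    else if l = a + 2 then Polynomial.C (Polynomial.C Polynomial.X) else 1 :
      Fin 4 → Polynomial (Polynomial (Polynomial k)))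

theorem lineExpansion_X (a l : Fin 4) : lineExpansion a (X l : MvPolynomial (Fin 4) k) =
    if l = a then Polynomial.X else if l = a + 1 then Polynomial.C Polynomial.X
    else if l = a + 2 then Polynomial.C (Polynomial.C Polynomial.X) else 1 :=
  aeval_X _ _

theorem lineExpansion_monomial (a : Fin 4) (m : Fin 4 →₀ ℕ) (c : k) :
    lineExpansion a (monomial m c) = Polynomial.monomial (m a) (Polynomial.monomial (m (a + 1))
      (Polynomial.monomial (m (a + 2)) c)) := by
  rw [lineExpansion, aeval_monomial, Finsupp.prod_fintype _ _ (fun _ => pow_zero _),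
    Fin.prod_univ_four]
  simp only [← Polynomial.C_mul_X_pow_eq_monomial, Polynomial.algebraMap_apply,
    Algebra.algebraMap_self, RingHom.id_apply]
  fin_cases a <;> simp <;> ring

theorem coeff_lineExpansion (a : Fin 4) (f : MvPolynomial (Fin 4) k) (A B c : ℕ) :
    (((lineExpansion a f).coeff A).coeff B).coeff c =
      ∑ m ∈ f.support, if m a = A ∧ m (a + 1) = B ∧ m (a + 2) = c then coeff m f else 0 := by
  conv_lhs => rw [f.as_sum]
  simp only [map_sum, Polynomial.finsetSum_coeff]
  refine Finset.sum_congr rfl fun m _ => ?_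
  rw [lineExpansion_monomial, Polynomial.coeff_monomial]
  split_ifs with h1 h2 h2
  · rw [Polynomial.coeff_monomial, if_pos h2.2.1, Polynomial.coeff_monomial, if_pos h2.2.2]
  · rw [Polynomial.coeff_monomial]
    split_ifs with h3
    · rw [Polynomial.coeff_monomial, if_neg fun h4 => h2 ⟨h1, h3, h4⟩]
    · simp
  · exact absurd h2.1 h1
  · simp

theorem degree_fin_four (a : Fin 4) (m : Fin 4 →₀ ℕ) :
    m.degree = m a + m (a + 1) + m (a + 2) + m (a + 3) := by
  rw [Finsupp.degree_eq_sum, Fin.sum_univ_four]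
  fin_cases a <;> simp <;> omega

theorem finsupp_fin_four_ext {a : Fin 4} {m m' : Fin 4 →₀ ℕ} (h0 : m a = m' a)
    (h1 : m (a + 1) = m' (a + 1)) (h2 : m (a + 2) = m' (a + 2)) (h3 : m (a + 3) = m' (a + 3)) :
    m = m' := by
  ext l
  fin_cases a <;> fin_cases l <;> simp_all

/-- Setting `X (a + 3)` to `1` loses nothing on forms: the degree recovers its exponent. -/
theorem coeff_lineExpansion_of_isHomogeneous (a : Fin 4) {f : MvPolynomial (Fin 4) k} {δ : ℕ}
    (hf : f.IsHomogeneous δ) {m : Fin 4 →₀ ℕ} (hm : m.degree = δ) :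
    (((lineExpansion a f).coeff (m a)).coeff (m (a + 1))).coeff (m (a + 2)) = coeff m f := by
  rw [coeff_lineExpansion, Finset.sum_eq_single m]
  · simp
  · intro m' hm' hne
    refine if_neg fun h => hne ?_
    have h1 := hf.degree_eq (mem_support_iff.1 hm')
    rw [degree_fin_four a] at h1 hm
    exact finsupp_fin_four_ext h.1 h.2.1 h.2.2 (by omega)
  · intro h
    rw [if_pos ⟨rfl, rfl, rfl⟩]
    exact notMem_support_iff.1 h

theorem exists_of_coeff_lineExpansion_ne_zero {a : Fin 4} {f : MvPolynomial (Fin 4) k} {δ : ℕ}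
    (hf : f.IsHomogeneous δ) {A B c : ℕ}
    (h : (((lineExpansion a f).coeff A).coeff B).coeff c ≠ 0) :
    ∃ m : Fin 4 →₀ ℕ, m.degree = δ ∧ m a = A ∧ m (a + 1) = B ∧ m (a + 2) = c ∧
      coeff m f ≠ 0 := by
  rw [coeff_lineExpansion] at h
  obtain ⟨m, hm, hne⟩ := Finset.exists_ne_zero_of_sum_ne_zero h
  obtain ⟨h1, h2, h3⟩ := (ite_ne_right_iff.1 hne).1
  have := mem_support_iff.1 hm
  exact ⟨m, hf.degree_eq this, h1, h2, h3, this⟩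

theorem eval_lineExpansion (a : Fin 4) (s : k) (f : MvPolynomial (Fin 4) k) :
    (((lineExpansion a f).coeff 0).coeff 0).eval s = eval (quadrilateralPoint a s) f := by
  simp only [Polynomial.coeff_zero_eq_eval_zero]
  induction f using MvPolynomial.induction_on with
  | C c => simp [lineExpansion, Polynomial.algebraMap_apply]
  | add p q hp hq => simp [hp, hq]
  | mul_X p l hp =>
    have hl : ∀ a l : Fin 4, l = a ∨ l = a + 1 ∨ l = a + 2 ∨ l = a + 3 := by decide
    have hX : (((lineExpansion a (X l : MvPolynomial (Fin 4) k)).eval 0).eval 0).eval s =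
        quadrilateralPoint a s l := by
      rw [lineExpansion_X]
      rcases hl a l with rfl | rfl | rfl | rfl <;> simp [quadrilateralPoint]
    rw [map_mul, map_mul, eval_X, Polynomial.eval_mul, Polynomial.eval_mul, Polynomial.eval_mul,
      hp, hX]

/-- Each factor from the point ideal either has positive order along the line, or contributes its
restriction to the line, which is divisible by `X - s`. -/
theorem dvd_coeff_lineExpansion {a : Fin 4} {s : k} (hv : quadrilateralPoint a s ≠ 0) {n : ℕ}
    {f : MvPolynomial (Fin 4) k}
    (hf : f ∈ pointIdeal (Projectivization.mk k (quadrilateralPoint a s) hv) ^ n) (A B : ℕ) :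
    (Polynomial.X - Polynomial.C s) ^ (n - (A + B)) ∣ ((lineExpansion a f).coeff A).coeff B := by
  induction n generalizing f A B with
  | zero => simp
  | succ n ih =>
    rw [pow_succ] at hf
    refine Submodule.mul_induction_on hf (fun r hr g hg => ?_) (fun x y hx hy => ?_)
    · rw [map_mul, Polynomial.coeff_mul, Polynomial.finsetSum_coeff]
      refine Finset.dvd_sum fun x hx => ?_
      rw [Polynomial.coeff_mul]
      refine Finset.dvd_sum fun y hy => ?_
      rw [Finset.HasAntidiagonal.mem_antidiagonal] at hx hy
      by_cases h : x.2 + y.2 = 0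
      · have h1 : (Polynomial.X - Polynomial.C s) ∣
            ((lineExpansion a g).coeff x.2).coeff y.2 := by
          rw [Polynomial.dvd_iff_isRoot, Polynomial.IsRoot, show x.2 = 0 by omega,
            show y.2 = 0 by omega, eval_lineExpansion]
          exact pointIdeal_le_ker_eval _ hv hg
        refine (pow_dvd_pow _ (show n + 1 - (A + B) ≤ n - (x.1 + y.1) + 1 by omega)).trans ?_
        rw [pow_succ]
        exact mul_dvd_mul (ih hr _ _) h1
      · refine Dvd.dvd.mul_right ?_ _
        exact (pow_dvd_pow _ (by omega)).trans (ih hr x.1 y.1)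
    · simpa using dvd_add hx hy

/-- A polynomial of degree at most `A + 2 n` divisible by `X ^ A`, `(X - 1) ^ n` and
`(X - t) ^ n` is a multiple of their product. -/
theorem Polynomial.coeff_of_dvd_of_dvd {G : Polynomial k} {t : k} (ht0 : t ≠ 0) (ht1 : t ≠ 1)
    {A n : ℕ} (hlow : ∀ c < A, G.coeff c = 0) (hdeg : ∀ c, A + 2 * n < c → G.coeff c = 0)
    (h1 : (X - C 1) ^ n ∣ G) (ht : (X - C t) ^ n ∣ G) :
    G.coeff A = t ^ n * G.coeff (A + 2 * n) ∧ (G.coeff (A + 2 * n) = 0 → G = 0) := by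
  have hA : (X - C 0) ^ A ∣ G := by
    rw [C_0, sub_zero]
    exact X_pow_dvd_iff.2 hlow
  have hc : ∀ x y : k, x ≠ y → ∀ i j, IsCoprime ((X - C x) ^ i) ((X - C y) ^ j) :=
    fun x y hxy i j => (isCoprime_X_sub_C_of_isUnit_sub (sub_ne_zero.2 hxy).isUnit).pow
  set D : Polynomial k := (X - C 1) ^ n * (X - C t) ^ n with hD
  have h2 : D ∣ G := (hc _ _ ht1.symm _ _).mul_dvd h1 ht
  have h3 : (X - C 0) ^ A * D ∣ G :=
    ((hc _ _ one_ne_zero.symm _ _).mul_right (hc _ _ ht0.symm _ _)).mul_dvd hA h2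
  rw [C_0, sub_zero] at h3
  obtain ⟨q, hq⟩ := h3
  have hDm : D.Monic := ((monic_X_sub_C 1).pow n).mul ((monic_X_sub_C t).pow n)
  have hDd : D.natDegree = 2 * n := by
    rw [hD, ((monic_X_sub_C 1).pow n).natDegree_mul ((monic_X_sub_C t).pow n), natDegree_pow,
      natDegree_pow, natDegree_X_sub_C, natDegree_X_sub_C]
    ring
  have hEm : (X ^ A * D).Monic := (monic_X_pow A).mul hDm
  have hEd : (X ^ A * D).natDegree = A + 2 * n := by
    rw [(monic_X_pow A).natDegree_mul hDm, natDegree_X_pow, hDd]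
  have hGd : G.natDegree ≤ A + 2 * n := natDegree_le_iff_coeff_eq_zero.2 fun c => hdeg c
  have hq0 : q.natDegree = 0 := by
    by_cases h0 : q = 0
    · simp [h0]
    · rw [hq, hEm.natDegree_mul' h0, hEd] at hGd
      omega
  obtain ⟨c, rfl⟩ := natDegree_eq_zero.1 hq0
  have htop : G.coeff (A + 2 * n) = c := by
    rw [hq, coeff_mul_C, ← hEd, coeff_natDegree, hEm.leadingCoeff, one_mul]
  -- The constant term of `D` is `(-1) ^ n * (-t) ^ n = t ^ n`.
  have hbot : G.coeff A = t ^ n * c := by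
    rw [hq, coeff_mul_C]
    congr 1
    have := coeff_X_pow_mul D A 0
    rw [zero_add] at this
    rw [this, coeff_zero_eq_eval_zero, hD]
    simp only [eval_mul, eval_pow, eval_sub, eval_X, eval_C, zero_sub, ← mul_pow]
    congr 1
    ring
  rw [htop, hbot]
  refine ⟨rfl, fun h => ?_⟩
  rw [hq, h, C_0, mul_zero]

/-- The order of vanishing of a monomial along the coordinate quadrilateral `x₀x₂ = x₁x₃ = 0`. -/
def quadrilateralOrder (m : Fin 4 →₀ ℕ) : ℕ := min (m 0) (m 2) + min (m 1) (m 3)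

theorem quadrilateralOrder_eq (a : Fin 4) (m : Fin 4 →₀ ℕ) :
    quadrilateralOrder m = min (m a) (m (a + 2)) + min (m (a + 1)) (m (a + 3)) := by
  rw [quadrilateralOrder]
  fin_cases a <;> simp <;> omega

/-- Along the line `a` found here, the order of `m` is just `m a + m (a + 1)`, so `m` is seen in a
lowest-order coefficient there. -/
theorem exists_line (m : Fin 4 →₀ ℕ) :
    ∃ a : Fin 4, m a ≤ m (a + 2) ∧ m (a + 1) ≤ m (a + 3) := by
  rcases le_total (m 0) (m 2) with h | h <;> rcases le_total (m 1) (m 3) with h' | h'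
  · exact ⟨0, h, h'⟩
  · exact ⟨3, h', h⟩
  · exact ⟨1, h', h⟩
  · exact ⟨2, h, h'⟩

/-- Forms of degree at most `2 μ` vanishing to order `μ` at two suitable points of each line of the
coordinate quadrilateral lie in the `μ`-th power of its ideal. -/
theorem coeff_eq_zero_of_quadrilateralOrder_lt {t : k} {μ δ : ℕ} (ht0 : t ≠ 0)
    (ht : ∀ n, 0 < n → n ≤ μ → t ^ (4 * n) ≠ 1) (hδ : δ ≤ 2 * μ) {f : MvPolynomial (Fin 4) k}
    (hf : f.IsHomogeneous δ)
    (h : ∀ a A B, (Polynomial.X - Polynomial.C 1) ^ (μ - (A + B)) ∣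
        ((lineExpansion a f).coeff A).coeff B ∧
      (Polynomial.X - Polynomial.C t) ^ (μ - (A + B)) ∣ ((lineExpansion a f).coeff A).coeff B)
    (m : Fin 4 →₀ ℕ) (hm : quadrilateralOrder m < μ) : coeff m f = 0 := by
  induction hj : quadrilateralOrder m using Nat.strong_induction_on generalizing m with
  | _ j ih =>
    rw [hj] at hm
    by_contra hne
    have hmδ := hf.degree_eq hne
    obtain ⟨n, hn⟩ : ∃ n, μ = j + n := ⟨μ - j, by omega⟩
    let b : Fin 4 →₀ ℕ := Finsupp.equivFunOnFinite.symm fun l => min (m l) (m (l + 2))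
    have hb : ∀ l, b l = min (m l) (m (l + 2)) := fun l => rfl
    have hb2 : ∀ l, b (l + 2) = b l := fun l => by
      rw [hb, hb, add_assoc, show (2 + 2 : Fin 4) = 0 from rfl, add_zero, min_comm]
    have hbj : ∀ a, b a + b (a + 1) = j := fun a => by
      rw [← hj, quadrilateralOrder_eq a m, hb, hb, add_assoc a 1 2]
      rfl
    let G : Fin 4 → Polynomial k := fun a => ((lineExpansion a f).coeff (b a)).coeff (b (a + 1))
    -- By induction no monomial of order below `j` occurs. This bounds the exponents in `G a` on
    -- both sides, leaving room for only `2 * n` roots away from `0`.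
    have hG : ∀ a c, (G a).coeff c ≠ 0 → b a ≤ c ∧ c + 2 * j ≤ b a + δ := by
      intro a c hc
      obtain ⟨m', hd, h0, h1, h2, hne'⟩ := exists_of_coeff_lineExpansion_ne_zero hf hc
      have h3 : ¬ quadrilateralOrder m' < j := fun h3 =>
        hne' (ih _ h3 m' (h3.trans hm) rfl)
      rw [quadrilateralOrder_eq a] at h3
      rw [degree_fin_four a] at hd
      have := hbj a
      omega
    have ht1 : t ≠ 1 := fun h1 => ht n (by omega) (by omega) (by rw [h1, one_pow])
    have hcyc : ∀ a, (G a).coeff (b a) = t ^ n * (G a).coeff (b a + 2 * n) ∧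
        ((G a).coeff (b a + 2 * n) = 0 → G a = 0) := by
      intro a
      have h1 := h a (b a) (b (a + 1))
      rw [hbj a, show μ - j = n by omega] at h1
      refine Polynomial.coeff_of_dvd_of_dvd ht0 ht1 (fun c hc => ?_) (fun c hc => ?_) h1.1 h1.2
      · by_contra h2
        have := (hG a c h2).1
        omega
      · by_contra h2
        have := (hG a c h2).2
        omega
    have htop : ∀ a, (G a).coeff (b a + 2 * n) = 0 := by
      rcases hδ.lt_or_eq with hlt | heq
      · intro a
        by_contra h2
        have := (hG a _ h2).2
        omega
      -- `κ c` is the coefficient at the corner `c`: the top one on the line `c + 2` and the bottom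
      -- one on the line `c + 1`.
      · let κ : Fin 4 → k := fun c => coeff (b + Finsupp.single c (2 * n)) f
        have hdeg : ∀ c, (b + Finsupp.single c (2 * n)).degree = δ := fun c => by
          have h0 := hbj 0
          have h2 := hb2 0
          have h3 := hb2 1
          rw [map_add, Finsupp.degree_single, degree_fin_four 0]
          simp only [zero_add] at h0 h2 h3 ⊢
          rw [show (1 + 2 : Fin 4) = 3 from rfl] at h3
          omega
        have hne4 : ∀ a : Fin 4, a + 2 ≠ a ∧ a + 2 ≠ a + 1 ∧ a + 3 ≠ a ∧ a + 3 ≠ a + 1 ∧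
            a + 3 ≠ a + 2 := by decide
        have hκtop : ∀ a, (G a).coeff (b a + 2 * n) = κ (a + 2) := by
          intro a
          have h1 := coeff_lineExpansion_of_isHomogeneous a hf (hdeg (a + 2))
          obtain ⟨n1, n2, -⟩ := hne4 a
          simp only [Finsupp.add_apply, Finsupp.single_apply, if_neg n1, if_neg n2, if_true, add_zero,
            hb2] at h1
          exact h1
        have hκbot : ∀ a, (G a).coeff (b a) = κ (a + 3) := by
          intro a
          have h1 := coeff_lineExpansion_of_isHomogeneous a hf (hdeg (a + 3))
          obtain ⟨-, -, n1, n2, n3⟩ := hne4 a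
          simp only [Finsupp.add_apply, Finsupp.single_apply, if_neg n1, if_neg n2, if_neg n3,
            add_zero, hb2] at h1
          exact h1
        have hstep : ∀ c, κ (c + 1) = t ^ n * κ c := by
          intro c
          have h1 := (hcyc (c + 2)).1
          rw [hκtop, hκbot, add_assoc, add_assoc] at h1
          simpa [show (2 + 3 : Fin 4) = 1 from rfl, show (2 + 2 : Fin 4) = 0 from rfl] using h1
        intro a
        rw [hκtop]
        set c := a + 2
        have h4 : κ c = t ^ (4 * n) * κ c := by
          have h1 : κ (c + 1 + 1 + 1 + 1) = κ c := by
            congr 1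
            revert c
            fin_cases a <;> rfl
          rw [hstep, hstep, hstep, hstep] at h1
          exact h1.symm.trans (by ring)
        by_contra h0
        exact ht n (by omega) (by omega) (mul_right_cancel₀ h0 (by rw [← h4, one_mul]))
    obtain ⟨a, ha1, ha2⟩ := exists_line m
    have h1 := coeff_lineExpansion_of_isHomogeneous a hf hmδ
    have h2 : G a = 0 := (hcyc a).2 (htop a)
    have h3 : b a = m a := by rw [hb, min_eq_left ha1]
    have h4 : b (a + 1) = m (a + 1) := by
      rw [hb, add_assoc a 1 2, show (1 + 2 : Fin 4) = 3 from rfl, min_eq_left ha2]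
    simp only [G, h3, h4] at h2
    rw [h2, Polynomial.coeff_zero] at h1
    exact hne h1.symm

/-- The excluded values are the roots of one monic polynomial, hence finitely many in any
characteristic. -/
theorem exists_pow_four_mul_ne_one (k : Type*) [Field k] [Infinite k] (μ : ℕ) :
    ∃ t : k, t ≠ 0 ∧ ∀ n, 0 < n → n ≤ μ → t ^ (4 * n) ≠ 1 := by
  classical
  let p : Polynomial k := Polynomial.X *
    ∏ n ∈ Finset.range μ, (Polynomial.X ^ (4 * (n + 1)) - Polynomial.C 1)
  have hp : p.Monic := Polynomial.monic_X.mul (Polynomial.monic_prod_of_monic _ _ fun n _ =>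
    Polynomial.monic_X_pow_sub_C _ (by omega))
  obtain ⟨t, ht⟩ := Infinite.exists_notMem_finset p.roots.toFinset
  rw [Multiset.mem_toFinset, Polynomial.mem_roots hp.ne_zero, Polynomial.IsRoot] at ht
  simp only [p, Polynomial.eval_mul, Polynomial.eval_X, Polynomial.eval_prod, mul_eq_zero, not_or,
    Finset.prod_eq_zero_iff, not_exists, not_and] at ht
  refine ⟨t, ht.1, fun n h0 hn h1 => ht.2 (n - 1) (Finset.mem_range.2 (by omega)) ?_⟩
  rw [show n - 1 + 1 = n by omega]
  simp [h1]

end Quadrilateral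

/-! ### Conditions imposed by fat points. -/

section FatPoints

variable {d r : ℕ}

/-- The principal parts of order `n` at the points `v i`, in the chart of the coordinate `j i`, of
forms of degree `n + e`. -/
noncomputable def principalParts {R : Type*} [CommRing R] (n e : ℕ) (j : Fin r → Fin (d + 1))
    (v : Fin r × Fin (d + 1) → R) :
    MvPolynomial (Fin (d + 1)) R →ₗ[R]
      (Fin r × (Finset.univ : Finset (Fin (d + 1))).finsuppAntidiag n → R) :=
  LinearMap.pi fun x => lcoeff R (x.2.1 + Finsupp.single (j x.1) e) ∘ₗ
    (shear (j x.1) fun l => v (x.1, l)).toLinearMap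

theorem principalParts_apply {R : Type*} [CommRing R] (n e : ℕ) (j : Fin r → Fin (d + 1))
    (v : Fin r × Fin (d + 1) → R) (f : MvPolynomial (Fin (d + 1)) R)
    (x : Fin r × (Finset.univ : Finset (Fin (d + 1))).finsuppAntidiag n) :
    principalParts n e j v f x = coeff (x.2.1 + Finsupp.single (j x.1) e)
      (shear (j x.1) (fun l => v (x.1, l)) f) := rfl

variable {k : Type*} [Field k]

/-- The polynomial is obtained by taking principal parts at the generic points with coordinates `X`.
-/
theorem exists_polynomial_principalParts (n e : ℕ) (j : Fin r → Fin (d + 1))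
    (f : MvPolynomial (Fin (d + 1)) k)
    (ℓ : (Fin r × (Finset.univ : Finset (Fin (d + 1))).finsuppAntidiag n → k) →ₗ[k] k) :
    ∃ P : MvPolynomial (Fin r × Fin (d + 1)) k, ∀ v, eval v P = ℓ (principalParts n e j v f) := by
  classical
  refine ⟨∑ x, principalParts n e j X (map C f) x * C (ℓ fun y => if x = y then 1 else 0),
    fun v => ?_⟩
  rw [LinearMap.pi_apply_eq_sum_univ, map_sum]
  refine Finset.sum_congr rfl fun x _ => ?_
  rw [map_mul, eval_C, smul_eq_mul, principalParts_apply, principalParts_apply, ← coeff_map,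
    map_shear, map_map]
  simp only [eval_X]
  rw [show (eval v).comp C = RingHom.id k from RingHom.ext fun a => eval_C a, map_id]

/-- A monomial of degree `n + e` has order at most `n` at the `j`-th coordinate point exactly when
it is divisible by `X j ^ e`. -/
theorem principalParts_eq_zero_iff {n e : ℕ} {j : Fin r → Fin (d + 1)}
    {v : Fin r → Fin (d + 1) → k} (hv : ∀ i, v i ≠ 0) (hj : ∀ i, v i (j i) ≠ 0)
    {f : MvPolynomial (Fin (d + 1)) k} (hf : f.IsHomogeneous (n + e)) :
    principalParts n e j (fun x => v x.1 x.2) f = 0 ↔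
      ∀ i, f ∈ pointIdeal (Projectivization.mk k (v i) (hv i)) ^ (n + 1) := by
  simp only [mem_pointIdeal_pow_iff (hv _) (hj _), mem_coordIdeal_pow]
  constructor
  · intro h i m hm
    by_contra hne
    have hd := (isHomogeneous_shear (j i) (v i) hf).degree_eq hne
    have hle : Finsupp.single (j i) e ≤ m := Finsupp.single_le_iff.2 (by omega)
    have h1 := tsub_add_cancel_of_le hle
    have h2 := congrArg Finsupp.degree h1
    rw [map_add, Finsupp.degree_single] at h2
    have h3 := congrFun h (i, ⟨m - Finsupp.single (j i) e, mem_finsuppAntidiag_univ.2 (by omega)⟩)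
    rw [principalParts_apply] at h3
    simp only [h1] at h3
    exact hne h3
  · intro h
    funext x
    refine h x.1 _ ?_
    have h1 := mem_finsuppAntidiag_univ.1 x.2.2
    rw [map_add, Finsupp.degree_single, Finsupp.add_apply, Finsupp.single_eq_same]
    omega

theorem mem_fatPointForms {δ : ℕ} {m : Fin r → ℕ} {p : Fin r → ℙ k (Fin (d + 1) → k)}
    {f : MvPolynomial (Fin (d + 1)) k} :
    f ∈ fatPointForms δ m p ↔ f.IsHomogeneous δ ∧ ∀ i, f ∈ pointIdeal (p i) ^ m i := by
  simp [fatPointForms]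

theorem fatPointForms_le (δ : ℕ) (m : Fin r → ℕ) (p : Fin r → ℙ k (Fin (d + 1) → k)) :
    fatPointForms δ m p ≤ homogeneousSubmodule (Fin (d + 1)) k δ := inf_le_left

instance (δ : ℕ) (m : Fin r → ℕ) (p : Fin r → ℙ k (Fin (d + 1) → k)) :
    FiniteDimensional k (fatPointForms δ m p) :=
  Submodule.finiteDimensional_of_le (fatPointForms_le δ m p)

theorem map_ker_principalParts {n e : ℕ} {j : Fin r → Fin (d + 1)} {v : Fin r → Fin (d + 1) → k}
    (hv : ∀ i, v i ≠ 0) (hj : ∀ i, v i (j i) ≠ 0) :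
    (LinearMap.ker ((principalParts n e j fun x => v x.1 x.2).domRestrict
      (homogeneousSubmodule (Fin (d + 1)) k (n + e)))).map (Submodule.subtype _) =
      fatPointForms (n + e) (fun _ => n + 1) fun i => Projectivization.mk k (v i) (hv i) := by
  ext f
  rw [mem_fatPointForms, Submodule.mem_map]
  constructor
  · rintro ⟨g, hg, rfl⟩
    exact ⟨g.2, (principalParts_eq_zero_iff hv hj g.2).1 hg⟩
  · rintro ⟨hf, h⟩
    exact ⟨⟨f, hf⟩, (principalParts_eq_zero_iff hv hj hf).2 h, rfl⟩

theorem finrank_range_principalParts_add {n e : ℕ} {j : Fin r → Fin (d + 1)}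
    {v : Fin r → Fin (d + 1) → k} (hv : ∀ i, v i ≠ 0) (hj : ∀ i, v i (j i) ≠ 0) :
    Module.finrank k (LinearMap.range ((principalParts n e j fun x => v x.1 x.2).domRestrict
      (homogeneousSubmodule (Fin (d + 1)) k (n + e)))) +
      Module.finrank k (fatPointForms (n + e) (fun _ => n + 1)
        fun i => Projectivization.mk k (v i) (hv i)) = (n + e + d).choose d := by
  rw [← map_ker_principalParts hv hj, Submodule.finrank_map_subtype_eq,
    LinearMap.finrank_range_add_finrank_ker, finrank_homogeneousSubmodule_fin]

theorem finrank_principalParts_target (n : ℕ) :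
    Module.finrank k (Fin r × (Finset.univ : Finset (Fin (d + 1))).finsuppAntidiag n → k) =
      r * (n + d).choose d := by
  rw [Module.finrank_fintype_fun_eq_card, Fintype.card_prod, Fintype.card_fin, Fintype.card_coe,
    card_finsuppAntidiag_fin]

/-- Fat points impose at most the expected number of conditions. -/
theorem choose_le_finrank_fatPointForms_add {n e : ℕ} {j : Fin r → Fin (d + 1)}
    {v : Fin r → Fin (d + 1) → k} (hv : ∀ i, v i ≠ 0) (hj : ∀ i, v i (j i) ≠ 0) :
    (n + e + d).choose d ≤ r * (n + d).choose d +
      Module.finrank k (fatPointForms (n + e) (fun _ => n + 1)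
        fun i => Projectivization.mk k (v i) (hv i)) := by
  rw [← finrank_range_principalParts_add hv hj, ← finrank_principalParts_target (k := k)]
  exact Nat.add_le_add_right (Submodule.finrank_le _) _

theorem surjective_principalParts_iff {n e : ℕ} {j : Fin r → Fin (d + 1)}
    {v : Fin r → Fin (d + 1) → k} (hv : ∀ i, v i ≠ 0) (hj : ∀ i, v i (j i) ≠ 0) :
    Function.Surjective ((principalParts n e j fun x => v x.1 x.2).domRestrict
      (homogeneousSubmodule (Fin (d + 1)) k (n + e))) ↔
      (n + e + d).choose d = r * (n + d).choose d +
        Module.finrank k (fatPointForms (n + e) (fun _ => n + 1)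
          fun i => Projectivization.mk k (v i) (hv i)) := by
  rw [← finrank_range_principalParts_add hv hj, ← finrank_principalParts_target (k := k),
    ← LinearMap.range_eq_top, Nat.add_right_cancel_iff]
  exact ⟨fun h => by rw [h, finrank_top], Submodule.eq_top_of_finrank_eq⟩

theorem injective_principalParts_iff {n e : ℕ} {j : Fin r → Fin (d + 1)}
    {v : Fin r → Fin (d + 1) → k} (hv : ∀ i, v i ≠ 0) (hj : ∀ i, v i (j i) ≠ 0) :
    Function.Injective ((principalParts n e j fun x => v x.1 x.2).domRestrict
      (homogeneousSubmodule (Fin (d + 1)) k (n + e))) ↔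
      fatPointForms (n + e) (fun _ => n + 1)
        (fun i => Projectivization.mk k (v i) (hv i)) = ⊥ := by
  rw [← map_ker_principalParts hv hj, ← LinearMap.ker_eq_bot, 
    ← Submodule.map_bot (homogeneousSubmodule (Fin (d + 1)) k (n + e)).subtype,
    (Submodule.map_injective_of_injective (Submodule.subtype_injective _)).eq_iff]

/-- Finitely many nonzero vectors avoid a common hyperplane. -/
theorem exists_linearForm_ne_zero [Infinite k] {v : Fin r → Fin (d + 1) → k}
    (hv : ∀ i, v i ≠ 0) : ∃ c : Fin (d + 1) → k, c ≠ 0 ∧ ∀ i, ∑ l, c l * v i l ≠ 0 := by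
  by_contra! h
  -- The factor `X 0` takes care of `c = 0`, where `h` says nothing.
  have h0 : (X 0 * ∏ i, ∑ l, X l * C (v i l) : MvPolynomial (Fin (d + 1)) k) = 0 := by
    refine MvPolynomial.funext fun c => ?_
    rw [map_mul, map_prod, map_zero, eval_X]
    by_cases hc : c = 0
    · rw [hc, Pi.zero_apply, zero_mul]
    · obtain ⟨i, hi⟩ := h c hc
      rw [Finset.prod_eq_zero (Finset.mem_univ i) (by simpa using hi), mul_zero]
  obtain ⟨i, -, hi⟩ := Finset.prod_eq_zero_iff.1 ((mul_eq_zero.1 h0).resolve_left (X_ne_zero 0))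
  refine hv i (_root_.funext fun l => ?_)
  have := congrArg (eval (Pi.single l 1)) hi
  simpa [Pi.single_apply] using this

theorem linearForm_ne_zero {c : Fin (d + 1) → k} (h : c ≠ 0) :
    (∑ l, C (c l) * X l : MvPolynomial (Fin (d + 1)) k) ≠ 0 := by
  intro h0
  refine h (_root_.funext fun l => ?_)
  have := congrArg (eval (Pi.single l 1)) h0
  simpa [Pi.single_apply] using this

/-- The number of conditions imposed by fat points does not decrease with the degree. -/
theorem finrank_fatPointForms_succ_le [Infinite k] (δ : ℕ) (m : Fin r → ℕ)
    {v : Fin r → Fin (d + 1) → k} (hv : ∀ i, v i ≠ 0) :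
    (δ + d).choose d + Module.finrank k (fatPointForms (δ + 1) m
        fun i => Projectivization.mk k (v i) (hv i)) ≤
      (δ + 1 + d).choose d + Module.finrank k (fatPointForms δ m
        fun i => Projectivization.mk k (v i) (hv i)) := by
  obtain ⟨c, hc0, hc⟩ := exists_linearForm_ne_zero hv
  set p := fun i => Projectivization.mk k (v i) (hv i) with hp
  let ℓ : MvPolynomial (Fin (d + 1)) k := ∑ l, C (c l) * X l
  have hℓ1 : ℓ.IsHomogeneous 1 := IsHomogeneous.sum _ _ _ fun l _ => (isHomogeneous_X _ _).C_mul _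
  have hinj : Function.Injective (LinearMap.mulLeft k ℓ) :=
    mul_right_injective₀ (linearForm_ne_zero hc0)
  -- Multiples of `ℓ` through the fat points come from forms of degree `δ` through them, so the
  -- dimension formula for `A` and `fatPointForms (δ + 1) m p` gives the bound.
  let A := (homogeneousSubmodule (Fin (d + 1)) k δ).map (LinearMap.mulLeft k ℓ)
  have hA : A ≤ homogeneousSubmodule (Fin (d + 1)) k (δ + 1) := by
    rintro _ ⟨f, hf, rfl⟩
    have := hℓ1.mul hf
    rwa [add_comm 1 δ] at this
  have hAF : A ⊓ fatPointForms (δ + 1) m p ≤ (fatPointForms δ m p).map (LinearMap.mulLeft k ℓ) := by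
    rintro _ ⟨⟨f, hf, rfl⟩, hF⟩
    exact ⟨f, mem_fatPointForms.2 ⟨hf, fun i =>
      mem_pointIdeal_pow_of_mul_mem (hv i) (hc i) ((mem_fatPointForms.1 hF).2 i)⟩, rfl⟩
  have h1 := Submodule.finrank_sup_add_finrank_inf_eq A (fatPointForms (δ + 1) m p)
  have h2 := Submodule.finrank_mono (sup_le hA (fatPointForms_le (δ + 1) m p))
  have h3 := Submodule.finrank_mono hAF
  have h4 : Module.finrank k A = (δ + d).choose d := by
    rw [← (Submodule.equivMapOfInjective _ hinj _).finrank_eq, finrank_homogeneousSubmodule_fin]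
  rw [← (Submodule.equivMapOfInjective _ hinj _).finrank_eq] at h3
  rw [finrank_homogeneousSubmodule_fin] at h2
  omega

/-- If there are no forms through the fat points in some degree, there are none in lower degrees. -/
theorem fatPointForms_eq_bot_of_le {δ δ' : ℕ} (h : δ ≤ δ') (m : Fin r → ℕ)
    (p : Fin r → ℙ k (Fin (d + 1) → k)) (h' : fatPointForms δ' m p = ⊥) :
    fatPointForms δ m p = ⊥ := by
  rw [eq_bot_iff] at h' ⊢
  intro f hf
  rw [mem_fatPointForms] at hf
  have : X 0 ^ (δ' - δ) * f ∈ fatPointForms δ' m p := by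
    refine mem_fatPointForms.2 ⟨?_, fun i => Ideal.mul_mem_left _ _ (hf.2 i)⟩
    have := (isHomogeneous_X_pow (R := k) (0 : Fin (d + 1)) (δ' - δ)).mul hf.1
    rwa [Nat.sub_add_cancel h] at this
  have h0 := h' this
  rw [Submodule.mem_bot, mul_eq_zero] at h0
  exact h0.resolve_left (pow_ne_zero _ (X_ne_zero _))

end FatPoints

/-! ### The special configuration and the dimension count. -/

section EightPoints

variable {k : Type*} [Field k]

/-- The eight points on the coordinate quadrilateral, two on each line. -/
def eightPoints (t : k) (i : Fin 8) : Fin 4 → k :=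
  quadrilateralPoint ((finProdFinEquiv (m := 4) (n := 2)).symm i).1
    (if ((finProdFinEquiv (m := 4) (n := 2)).symm i).2 = 0 then 1 else t)

/-- A coordinate that is nonzero at the given one of the eight points. -/
def eightPointsChart (i : Fin 8) : Fin 4 := ((finProdFinEquiv (m := 4) (n := 2)).symm i).1 + 3

theorem eightPoints_chart (t : k) (i : Fin 8) : eightPoints t i (eightPointsChart i) = 1 :=
  quadrilateralPoint_apply_add_three _ _

theorem eightPoints_ne_zero (t : k) (i : Fin 8) : eightPoints t i ≠ 0 := fun h =>
  one_ne_zero ((eightPoints_chart t i).symm.trans (congrFun h _))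

theorem coeff_eq_zero_of_mem_fatPointForms {t : k} {μ δ : ℕ} (ht0 : t ≠ 0)
    (ht : ∀ n, 0 < n → n ≤ μ → t ^ (4 * n) ≠ 1) (hδ : δ ≤ 2 * μ) {f : MvPolynomial (Fin 4) k}
    (hf : f ∈ fatPointForms δ (fun _ => μ)
      fun i => Projectivization.mk k (eightPoints t i) (eightPoints_ne_zero t i))
    (m : Fin 4 →₀ ℕ) (hm : quadrilateralOrder m < μ) : coeff m f = 0 := by
  rw [mem_fatPointForms] at hf
  refine coeff_eq_zero_of_quadrilateralOrder_lt ht0 ht hδ hf.1 (fun a A B => ⟨?_, ?_⟩) m hm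
  · have h := hf.2 (finProdFinEquiv (a, (0 : Fin 2)))
    have he : eightPoints t (finProdFinEquiv (a, (0 : Fin 2))) = quadrilateralPoint a 1 := by
      simp [eightPoints]
    simp only [he] at h
    exact dvd_coeff_lineExpansion _ h A B
  · have h := hf.2 (finProdFinEquiv (a, (1 : Fin 2)))
    have he : eightPoints t (finProdFinEquiv (a, (1 : Fin 2))) = quadrilateralPoint a t := by
      simp [eightPoints]
    simp only [he] at h
    exact dvd_coeff_lineExpansion _ h A B

theorem two_mul_quadrilateralOrder_le (m : Fin 4 →₀ ℕ) : 2 * quadrilateralOrder m ≤ m.degree := by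
  rw [degree_fin_four 0, quadrilateralOrder_eq 0]
  omega

theorem fatPointForms_eightPoints_eq_bot {t : k} {μ δ : ℕ} (ht0 : t ≠ 0)
    (ht : ∀ n, 0 < n → n ≤ μ → t ^ (4 * n) ≠ 1) (hδ : δ < 2 * μ) :
    fatPointForms δ (fun _ => μ)
      (fun i => Projectivization.mk k (eightPoints t i) (eightPoints_ne_zero t i)) = ⊥ := by
  rw [eq_bot_iff]
  intro f hf
  rw [Submodule.mem_bot]
  ext m
  rw [coeff_zero]
  by_contra hne
  refine hne (coeff_eq_zero_of_mem_fatPointForms ht0 ht hδ.le hf m ?_)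
  have := (mem_fatPointForms.1 hf).1.degree_eq hne
  have := two_mul_quadrilateralOrder_le m
  omega

/-- Order at least `μ` in degree `2 * μ` forces `m 0 = m 2` and `m 1 = m 3`, so `m 0` determines the
monomial. -/
theorem finrank_fatPointForms_eightPoints_le {t : k} {μ : ℕ} (ht0 : t ≠ 0)
    (ht : ∀ n, 0 < n → n ≤ μ → t ^ (4 * n) ≠ 1) :
    Module.finrank k (fatPointForms (2 * μ) (fun _ => μ) fun i =>
      Projectivization.mk k (eightPoints t i) (eightPoints_ne_zero t i)) ≤ μ + 1 := by
  let e : Fin (μ + 1) → Fin 4 →₀ ℕ := fun i =>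
    Finsupp.equivFunOnFinite.symm ![i, μ - i, i, μ - i]
  let E : MvPolynomial (Fin 4) k →ₗ[k] (Fin (μ + 1) → k) :=
    LinearMap.pi fun i => lcoeff k (e i)
  have hinj : Function.Injective (E.domRestrict (fatPointForms (2 * μ) (fun _ => μ) fun i =>
      Projectivization.mk k (eightPoints t i) (eightPoints_ne_zero t i))) := by
    rw [← LinearMap.ker_eq_bot, LinearMap.ker_eq_bot']
    rintro ⟨f, hf⟩ h
    rw [Submodule.mk_eq_zero]
    ext m
    rw [coeff_zero]
    by_contra hne
    have hd := (mem_fatPointForms.1 hf).1.degree_eq hne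
    have hw : ¬ quadrilateralOrder m < μ := fun hw =>
      hne (coeff_eq_zero_of_mem_fatPointForms ht0 ht le_rfl hf m hw)
    rw [degree_fin_four 0] at hd
    rw [quadrilateralOrder_eq 0] at hw
    have hm : e ⟨m 0, by omega⟩ = m := by
      refine finsupp_fin_four_ext (a := 0) rfl ?_ ?_ ?_
      · change μ - m 0 = m (0 + 1); omega
      · change m 0 = m (0 + 2); omega
      · change μ - m 0 = m (0 + 3); omega
    have h1 := congrFun h ⟨m 0, by omega⟩
    refine hne ?_
    rw [← hm]
    exact h1
  simpa using LinearMap.finrank_le_finrank_of_injective hinj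

theorem six_mul_choose_three (n : ℕ) : 6 * (n + 3).choose 3 = (n + 1) * (n + 2) * (n + 3) := by
  have := Nat.descFactorial_eq_factorial_mul_choose (n + 3) 3
  simp [Nat.descFactorial, Nat.factorial] at this
  rw [← this]
  ring

/-- With `μ = n + 1`, the excess `n + 2 = μ + 1` matches the upper bound found at the special
points. -/
theorem choose_three_even (n : ℕ) :
    (2 * (n + 1) + 3).choose 3 = 8 * (n + 3).choose 3 + (n + 2) := by
  have h1 := six_mul_choose_three n
  have h2 := six_mul_choose_three (2 * (n + 1))
  have h3 : (2 * (n + 1) + 1) * (2 * (n + 1) + 2) * (2 * (n + 1) + 3) =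
    8 * ((n + 1) * (n + 2) * (n + 3)) + 6 * (n + 2) := by ring
  omega

theorem choose_three_odd_le (n : ℕ) : (2 * n + 1 + 3).choose 3 ≤ 8 * (n + 3).choose 3 := by
  have h1 := six_mul_choose_three n
  have h2 := six_mul_choose_three (2 * n + 1)
  have h3 : (2 * n + 1 + 1) * (2 * n + 1 + 2) * (2 * n + 1 + 3) ≤
    8 * ((n + 1) * (n + 2) * (n + 3)) := by ring_nf; gcongr <;> omega
  omega

/-- Fat points imposing independent conditions on forms of degree `2 (n + 1)` and lying on no form
of degree `2 n + 1` impose the expected number of conditions in every degree. -/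
theorem finrank_fatPointForms_eq [Infinite k] {n : ℕ} {v : Fin 8 → Fin (3 + 1) → k}
    (hv : ∀ i, v i ≠ 0) {j : Fin 8 → Fin (3 + 1)} (hj : ∀ i, v i (j i) ≠ 0)
    {p : Fin 8 → ℙ k (Fin (3 + 1) → k)} (hp : p = fun i => Projectivization.mk k (v i) (hv i))
    (h1 : fatPointForms (n + (n + 1)) (fun _ => n + 1) p = ⊥)
    (h2 : Module.finrank k (fatPointForms (n + (n + 2)) (fun _ => n + 1) p) = n + 2) (δ : ℕ) :
    (Module.finrank k (fatPointForms δ (fun _ => n + 1) p) : ℤ) = max 0 (virtualDim 3 δ 8 (n + 1)) := by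
  rw [virtualDim, show 3 + (n + 1) - 1 = n + 3 by omega]
  rcases le_or_gt δ (n + (n + 1)) with hδ | hδ
  · rw [fatPointForms_eq_bot_of_le hδ _ _ h1, finrank_bot]
    have h3 := Nat.choose_le_choose 3 (show δ + 3 ≤ 2 * n + 1 + 3 by omega)
    have h4 := choose_three_odd_le n
    push_cast
    omega
  -- The first bound counts conditions; the second propagates upwards from degree `2 * (n + 1)`.
  · have hle : ∀ δ, n + (n + 2) ≤ δ → (δ + 3).choose 3 ≤
        8 * (n + 3).choose 3 + Module.finrank k (fatPointForms δ (fun _ => n + 1) p) ∧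
        8 * (n + 3).choose 3 + Module.finrank k (fatPointForms δ (fun _ => n + 1) p) ≤ (δ + 3).choose 3 := by
      intro δ hδ
      constructor
      · obtain ⟨e, rfl⟩ : ∃ e, δ = n + e := ⟨δ - n, by omega⟩
        rw [hp]
        exact choose_le_finrank_fatPointForms_add hv hj
      · induction δ, hδ using Nat.le_induction with
        | base =>
          rw [h2, show n + (n + 2) = 2 * (n + 1) by ring, choose_three_even]
        | succ δ hδ ih =>
          have h3 := finrank_fatPointForms_succ_le (d := 3) δ (fun _ => n + 1) hv
          rw [← hp] at h3
          omega
    have h3 := hle δ (by omega)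
    rw [max_eq_right (by push_cast; omega), ← le_antisymm h3.2 h3.1]
    push_cast
    exact (add_sub_cancel_left _ _).symm

end EightPoints

theorem mainTheorem4 (k : Type*) [Field k] [IsAlgClosed k] (μ : ℕ) :
    ForGeneralPoints (k := k) (d := 3) (r := 8) (fun p =>
      ∀ δ : ℕ, (Module.finrank k (fatPointForms δ (fun _ => μ) p) : ℤ) =
        max 0 (virtualDim 3 δ 8 μ)) := by
  have : Infinite k := IsAlgClosed.instInfinite
  obtain ⟨t, ht0, ht⟩ := exists_pow_four_mul_ne_one k μ
  rcases μ with _ | n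
  -- `μ = 0` is separate because principal parts of order `n` encode multiplicity `n + 1`.
  · refine forGeneralPoints_of_polynomial 1 (eightPoints t) (eightPoints_ne_zero t) (by simp)
      fun v hv _ δ => ?_
    have : fatPointForms δ (fun _ => 0) (fun i => Projectivization.mk k (v i) (hv i)) =
        homogeneousSubmodule (Fin 4) k δ := by
      ext f
      simp [mem_fatPointForms]
    rw [this, finrank_homogeneousSubmodule_fin]
    simp [virtualDim]
  · let L := fun e (v : Fin 8 × Fin 4 → k) => (principalParts n e eightPointsChart v).domRestrict
      (homogeneousSubmodule (Fin 4) k (n + e))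
    have hL : ∀ e (f : homogeneousSubmodule (Fin 4) k (n + e))
        (ℓ : (Fin 8 × (Finset.univ : Finset (Fin 4)).finsuppAntidiag n → k) →ₗ[k] k),
        ∃ P : MvPolynomial (Fin 8 × Fin 4) k, ∀ v, eval v P = ℓ (L e v f) :=
      fun e f ℓ => exists_polynomial_principalParts n e _ f.1 ℓ
    have hj : ∀ i, eightPoints t i (eightPointsChart i) ≠ 0 := fun i => by
      rw [eightPoints_chart]; exact one_ne_zero
    have hN : (n + (n + 2) + 3).choose 3 = 8 * (n + 3).choose 3 + (n + 2) := by
      rw [← choose_three_even, show 2 * (n + 1) = n + (n + 2) by ring]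
    obtain ⟨f₁, hf₁, h₁⟩ := exists_polynomial_injective (L (n + 1)) (hL _)
      (fun x => eightPoints t x.1 x.2) ((injective_principalParts_iff (eightPoints_ne_zero t) hj).2
        (fatPointForms_eightPoints_eq_bot ht0 ht (by omega)))
    obtain ⟨f₂, hf₂, h₂⟩ := exists_polynomial_surjective (L (n + 2)) (hL _)
      (fun x => eightPoints t x.1 x.2) ((surjective_principalParts_iff (eightPoints_ne_zero t) hj).2 (by
        have h1 := finrank_fatPointForms_eightPoints_le ht0 ht
        rw [show 2 * (n + 1) = n + (n + 2) by ring] at h1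
        have h2 := choose_le_finrank_fatPointForms_add (n := n) (e := n + 2)
          (eightPoints_ne_zero t) hj
        rw [hN] at h2 ⊢
        omega))
    -- The product of coordinates keeps every point in the chart used at the special configuration.
    refine forGeneralPoints_of_polynomial ((∏ i, X (i, eightPointsChart i)) * (f₁ * f₂))
      (eightPoints t) (eightPoints_ne_zero t) ?_ fun v hv hne => ?_
    · rw [map_mul, map_mul, map_prod]
      refine mul_ne_zero (Finset.prod_ne_zero_iff.2 fun i _ => ?_) (mul_ne_zero hf₁ hf₂)
      rw [eval_X]
      exact hj i
    · rw [map_mul, map_mul, map_prod] at hne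
      obtain ⟨hne0, hne12⟩ := mul_ne_zero_iff.1 hne
      obtain ⟨hne1, hne2⟩ := mul_ne_zero_iff.1 hne12
      have hvj : ∀ i, v i (eightPointsChart i) ≠ 0 := fun i => by
        have := Finset.prod_ne_zero_iff.1 hne0 i (Finset.mem_univ i)
        rwa [eval_X] at this
      refine finrank_fatPointForms_eq hv hvj rfl ((injective_principalParts_iff hv hvj).1 (h₁ _ hne1)) ?_
      have h3 := (surjective_principalParts_iff hv hvj).1 (h₂ _ hne2)
      rw [hN] at h3
      omega
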